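/- Let $q$ be a prime power, let $n$ be a positive even integer, let $\lambda \in \mathbb{F}_{q^n} \setminus \mathbb{F}_{q^2}$, put $t = [\mathbb{F}_{q^2}(\lambda) : \mathbb{F}_{q^2}]$, and let $l$ be an integer with $1 \le l < t/2$. Let $$S = \langle 1, \lambda, \ldots, \lambda^{l-1} \rangle_{\mathbb{F}_{q^2}} + \lambda^l \mathbb{F}_q \subseteq \mathbb{F}_{q^n}.$$ Let $\mathrm{Orb}(S) = \{\alpha S : \alpha \in \mathbb{F}_{q^n}^*\}$, and for $\mathbb{F}_q$-subspaces $U, V$ of $\mathbb{F}_{q^n}$ of the same dimension $k$ let $d(U,V) = 2k - 2\dim_{\mathbb{F}_q}(U \cap V)$. For $i \ge 1$ let $$\omega_{2i} = \bigl|\{T \in \mathrm{Orb}(S) : d(S, T) = 2i\}\bigr|.$$ Then the sum defining $S$ is direct, $\dim_{\mathbb{F}_q} S = 2l+1$, $|\mathrm{Orb}(S)| = \frac{q^n-1}{q-1}$, and the weight distribution $(\omega_2, \omega_4, \ldots, \omega_{4l+2})$ of $\mathrm{Orb}(S)$ is given by $$\omega_{2i} = \begin{cases} q, & i = 1, \\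 q^{4r-1}(q^2-1), & i = 2r+1,\ r \in \{1, \ldots, l-1\}, \\ q^{4r-2}(q+1)^2, & i = 2r,\ r \in \{1, \ldots, l\}, \\ \frac{q^n-1}{q-1} - (q+1) - (q+1)q^2\,\frac{(q^{4l-3}-q)(q-1) + (q+1)(q^{4l}-1)}{q^4-1}, & i = 2l+1. \end{cases}$$ -/

import Mathlib

open scoped Pointwise

noncomputable section

/-- The subspace distance `dim U + dim V - 2 dim (U ∩ V)`. On finite-dimensional subspaces the
subtraction never truncates, and on subspaces of common dimension `k` the value is
`2k - 2 dim (U ∩ V)`. -/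
def subspaceDist {K L : Type*} [Field K] [Field L] [Algebra K L] (U V : Submodule K L) : ℕ :=
  Module.finrank K U + Module.finrank K V - 2 * Module.finrank K (U ⊓ V : Submodule K L)

/-- The one-orbit cyclic subspace code `Orb(S) = {α S : α ∈ Lˣ}`. -/
def cyclicOrbit {K L : Type*} [Field K] [Field L] [Algebra K L] (S : Submodule K L) :
    Set (Submodule K L) :=
  MulAction.orbit Lˣ S

/-- The entry `ω_w` of the distance weight distribution of `Orb(S)`: the number of codewords
(subspaces, not multipliers) at distance `w` from `S`. -/
def orbitWeight {K L : Type*} [Field K] [Field L] [Algebra K L] (S : Submodule K L) (w : ℕ) : ℕ :=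
  Set.ncard {T : Submodule K L | T ∈ cyclicOrbit S ∧ subspaceDist S T = w}

/-- The `K`-subspace underlying the `E`-span of `1, x, …, x ^ (l - 1)`. -/
def powerSpan {K L : Type*} [Field K] [Field L] [Algebra K L] (E : IntermediateField K L)
    (x : L) (l : ℕ) : Submodule K L :=
  (Submodule.span E {y : L | ∃ i < l, y = x ^ i}).restrictScalars K

/-- The sum `⟨1, x, …, x ^ (l - 1)⟩_E + x ^ l K`. -/
def fwsSpace {K L : Type*} [Field K] [Field L] [Algebra K L] (E : IntermediateField K L)
    (x : L) (l : ℕ) : Submodule K L :=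
  powerSpan E x l ⊔ Submodule.span K {x ^ l}

end

/-! Evaluation at `x` identifies S with the polynomials over E of degree at most l whose coefficient
of degree l lies in K. If S ∩ αS ≠ 0, then α = f(x)/g(x) with f, g of degree at most l; since 2l <
t, the reduced fraction f₀/g₀ is determined up to a common scalar. Let m be the larger of its two
degrees and a, b its coefficients of degree m. Then S ∩ αS consists of the f₀(x)p(x) with deg p ≤ l
- m and top coefficient c satisfying ac, bc ∈ K. Such c form a K-space of size e = 1 or q, so the
distance is 4m + 2 or 4m respectively; it is 4l + 2 if α is no such ratio.

Reduced fractions are not counted directly. Counting pairs of nonzero elements of a subspace V gives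
∑ (|V ∩ αV| - 1) = (|V| - 1)² over all α (`sum_natCard_inf_smul`). Apply this to the truncated
spaces of every degree j ≤ l, with top coefficient in C = 0 or C = K. Subtracting q² times the
identity for j from that for j + 1 isolates the α with m ≤ j (for C = 0), then those with m = j + 1,
e = q (for C = K). Differences of these counts give the remaining distances. The stabilizer of S has
q - 1 elements, so dividing by q - 1 turns multipliers into codewords. -/

open Polynomial

/-! ### Polynomial model of S. -/

section TruncatedPolynomials

variable {K L : Type*} [Field K] [Field L] [Algebra K L]

/-- Polynomials of degree at most `j` whose coefficient of degree `j` lies in `C`. -/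
noncomputable def truncPoly (E : IntermediateField K L) (j : ℕ) (C : Submodule K E) : Submodule K E[X] :=
  (degreeLT E (j + 1)).restrictScalars K ⊓ C.comap ((lcoeff E j).restrictScalars K)

/-- The values at `x` of the polynomials in `truncPoly E j C`. -/
noncomputable def truncSpace (E : IntermediateField K L) (x : L) (j : ℕ) (C : Submodule K E) :
    Submodule K L :=
  (truncPoly E j C).map ((aeval x : E[X] →ₐ[E] L).toLinearMap.restrictScalars K)

/-- The elements which both `a` and `b` multiply into `C`. -/
def mulPreimage {E : IntermediateField K L} (C : Submodule K E) (a b : E) : Submodule K E :=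
  C.comap (LinearMap.mulLeft K a) ⊓ C.comap (LinearMap.mulLeft K b)

theorem mem_truncPoly {E : IntermediateField K L} {j : ℕ} {C : Submodule K E} {f : E[X]} :
    f ∈ truncPoly E j C ↔ f.natDegree ≤ j ∧ f.coeff j ∈ C := by
  have h : f ∈ degreeLT E (j + 1) ↔ f.natDegree ≤ j := by
    rw [mem_degreeLT, degree_lt_iff_coeff_zero, natDegree_le_iff_coeff_eq_zero]
    rfl
  simp [truncPoly, h]

theorem mem_truncSpace {E : IntermediateField K L} {x : L} {j : ℕ} {C : Submodule K E} {y : L} :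
    y ∈ truncSpace E x j C ↔ ∃ f : E[X], (f.natDegree ≤ j ∧ f.coeff j ∈ C) ∧ aeval x f = y := by
  simp [truncSpace, mem_truncPoly]

theorem mem_mulPreimage {E : IntermediateField K L} {C : Submodule K E} {a b c : E} :
    c ∈ mulPreimage C a b ↔ a * c ∈ C ∧ b * c ∈ C := by
  simp [mulPreimage]

theorem algebraMap_smul_one_mul {E : IntermediateField K L} (c : K) (y : L) :
    algebraMap E L (c • 1) * y = c • y := by
  rw [← Algebra.algebraMap_eq_smul_one, ← IsScalarTower.algebraMap_apply, ← Algebra.smul_def]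

theorem mem_powerSpan {E : IntermediateField K L} {x : L} {l : ℕ} {y : L} :
    y ∈ powerSpan E x l ↔ ∃ f ∈ degreeLT E l, aeval x f = y := by
  classical
  have h : Submodule.span E {y : L | ∃ i < l, y = x ^ i} =
      (degreeLT E l).map (aeval x : E[X] →ₐ[E] L).toLinearMap := by
    rw [degreeLT_eq_span_X_pow, Submodule.map_span]
    congr 1
    ext y
    simp [eq_comm]
  rw [powerSpan, Submodule.restrictScalars_mem, h]
  simp

theorem fwsSpace_eq_truncSpace (E : IntermediateField K L) (x : L) (l : ℕ) :
    fwsSpace E x l = truncSpace E x l (Submodule.span K {1}) := by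
  ext y
  simp only [fwsSpace, Submodule.mem_sup, mem_powerSpan, Submodule.mem_span_singleton,
    mem_truncSpace]
  constructor
  · rintro ⟨_, ⟨f, hf, rfl⟩, _, ⟨c, rfl⟩, rfl⟩
    rw [mem_degreeLT] at hf
    refine ⟨f + C (c • (1 : E)) * X ^ l, ⟨?_, c, ?_⟩, ?_⟩
    · exact natDegree_add_le_of_degree_le (natDegree_le_of_degree_le hf.le)
        (natDegree_C_mul_X_pow_le _ _)
    · simp [coeff_eq_zero_of_degree_lt hf]
    · rw [map_add, map_mul, aeval_C, map_pow, aeval_X, algebraMap_smul_one_mul]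
  · rintro ⟨f, ⟨hf, c, hc⟩, rfl⟩
    refine ⟨aeval x (f - C (f.coeff l) * X ^ l), ⟨_, ?_, rfl⟩, c • x ^ l, ⟨c, rfl⟩, ?_⟩
    · rw [mem_degreeLT, degree_lt_iff_coeff_zero]
      intro m hm
      rcases hm.eq_or_lt with rfl | hm
      · simp
      · simp [coeff_X_pow, hm.ne', coeff_eq_zero_of_natDegree_lt (hf.trans_lt hm)]
    · rw [map_sub, map_mul, aeval_C, map_pow, aeval_X, ← hc, algebraMap_smul_one_mul, sub_add_cancel]

theorem aeval_eq_zero_of_natDegree_lt {E : IntermediateField K L} {x : L} [FiniteDimensional K L]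
    {f : E[X]} (hf : f.natDegree < Module.finrank E (IntermediateField.adjoin E {x}))
    (h : aeval x f = 0) : f = 0 := by
  by_contra h0
  have hx : IsIntegral E x := (IsIntegral.of_finite K x).tower_top
  rw [IntermediateField.adjoin.finrank hx] at hf
  exact hf.not_ge (natDegree_le_natDegree (minpoly.degree_le_of_ne_zero E x h0 h))

theorem natCard_truncPoly (E : IntermediateField K L) (j : ℕ) (C : Submodule K E) :
    Nat.card (truncPoly E j C) = Nat.card E ^ j * Nat.card C := by
  have key (p : degreeLT E j × C) :
      (p.1 : E[X]) + Polynomial.C (p.2 : E) * X ^ j ∈ truncPoly E j C := by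
    have := mem_degreeLT.1 p.1.2
    rw [mem_truncPoly]
    refine ⟨natDegree_add_le_of_degree_le (natDegree_le_of_degree_le this.le)
      (natDegree_C_mul_X_pow_le _ _), ?_⟩
    simp [coeff_eq_zero_of_degree_lt this]
  have bij : Function.Bijective
      (fun p : degreeLT E j × C => (⟨_, key p⟩ : truncPoly E j C)) := by
    constructor
    · rintro ⟨⟨f, hf⟩, c⟩ ⟨⟨g, hg⟩, d⟩ h
      rw [mem_degreeLT] at hf hg
      have h' : f + Polynomial.C (c : E) * X ^ j = g + Polynomial.C (d : E) * X ^ j :=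
        congrArg Subtype.val h
      have hc : (c : E) = d := by
        have := congrArg (coeff · j) h'
        simpa [coeff_eq_zero_of_degree_lt hf, coeff_eq_zero_of_degree_lt hg] using this
      rw [hc, add_left_inj] at h'
      exact Prod.ext (Subtype.ext h') (Subtype.ext hc)
    · rintro ⟨f, hf⟩
      rw [mem_truncPoly] at hf
      refine ⟨⟨⟨f - Polynomial.C (f.coeff j) * X ^ j, ?_⟩, ⟨_, hf.2⟩⟩,
        Subtype.ext (sub_add_cancel _ _)⟩
      rw [mem_degreeLT, degree_lt_iff_coeff_zero]
      intro m hm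
      rcases hm.eq_or_lt with rfl | hm
      · simp
      · simp [coeff_X_pow, hm.ne', coeff_eq_zero_of_natDegree_lt (hf.1.trans_lt hm)]
  rw [← Nat.card_congr (Equiv.ofBijective _ bij), Nat.card_prod, Nat.card_congr (degreeLTEquiv E j).toEquiv, Nat.card_fun,
    Nat.card_fin]

theorem mem_inf_smul {S : Submodule K L} {α : Lˣ} {y : L} :
    y ∈ S ⊓ α • S ↔ y ∈ S ∧ ∃ z ∈ S, (α : L) * z = y := by
  change y ∈ S ∧ y ∈ (α : L) • S ↔ _
  rw [Submodule.mem_smul_pointwise_iff_exists]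
  rfl

end TruncatedPolynomials

/-! ### Intersections with multiples via reduced fractions. -/

section Intersections

variable {K L : Type*} [Field K] [Field L] [Algebra K L] [FiniteDimensional K L]

theorem aeval_injOn_of_natDegree_lt {E : IntermediateField K L} {x : L} {f g : E[X]}
    (hf : f.natDegree < Module.finrank E (IntermediateField.adjoin E {x}))
    (hg : g.natDegree < Module.finrank E (IntermediateField.adjoin E {x}))
    (h : aeval x f = aeval x g) : f = g :=
  sub_eq_zero.1 (aeval_eq_zero_of_natDegree_lt
    ((natDegree_sub_le f g).trans_lt (max_lt hf hg)) (by rw [map_sub, h, sub_self]))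

theorem natCard_truncSpace {E : IntermediateField K L} {x : L} {j : ℕ}
    (hj : j < Module.finrank E (IntermediateField.adjoin E {x})) (C : Submodule K E) :
    Nat.card (truncSpace E x j C) = Nat.card E ^ j * Nat.card C := by
  rw [← natCard_truncPoly E j C]
  refine (Nat.card_congr (Equiv.Set.imageOfInjOn _ _ ?_)).symm
  intro f hf g hg h
  exact aeval_injOn_of_natDegree_lt ((mem_truncPoly.1 hf).1.trans_lt hj)
    ((mem_truncPoly.1 hg).1.trans_lt hj) h

/-- Cross-multiplying gives f g₀ = f₀ g at `x`. Both sides have degree at most 2l < t, so this is an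
identity of polynomials, and coprimality yields f₀ ∣ f. This is where l < t/2 is essential. -/
theorem exists_mul_of_ratio_eq {E : IntermediateField K L} {x : L} {α : Lˣ} {l : ℕ}
    (hl : 2 * l < Module.finrank E (IntermediateField.adjoin E {x})) {f₀ g₀ f g : E[X]}
    (hcop : IsCoprime f₀ g₀) (hf₀ : f₀.natDegree ≤ l) (hg₀ : g₀.natDegree ≤ l)
    (h₀ : aeval x f₀ = α * aeval x g₀) (hf : f.natDegree ≤ l) (hg : g.natDegree ≤ l)
    (h : aeval x f = α * aeval x g) : ∃ p, f = f₀ * p ∧ g = g₀ * p := by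
  have hne : f₀ ≠ 0 := by
    rintro rfl
    have hg0 : g₀ = 0 := by
      refine aeval_eq_zero_of_natDegree_lt (x := x) (by omega) ?_
      simpa using h₀.symm
    simpa [hg0] using hcop.ne_zero_or_ne_zero
  have hfg : f * g₀ = f₀ * g := by
    refine aeval_injOn_of_natDegree_lt (x := x) ?_ ?_ ?_
    · have := natDegree_mul_le (p := f) (q := g₀)
      omega
    · have := natDegree_mul_le (p := f₀) (q := g)
      omega
    · rw [map_mul, map_mul, h, h₀]
      ring
  obtain ⟨p, rfl⟩ := hcop.dvd_of_dvd_mul_right (Dvd.intro _ hfg.symm)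
  refine ⟨p, rfl, mul_left_cancel₀ hne ?_⟩
  rw [← hfg]
  ring

theorem natDegree_add_max_le {F : Type*} [Field F] {f g p : F[X]} {j : ℕ} (hp : p ≠ 0)
    (hfg : f ≠ 0 ∨ g ≠ 0) (hf : (f * p).natDegree ≤ j) (hg : (g * p).natDegree ≤ j) :
    max f.natDegree g.natDegree + p.natDegree ≤ j := by
  by_cases hf0 : f = 0
  · subst hf0
    rw [natDegree_mul (by simpa using hfg) hp] at hg
    simpa using hg
  by_cases hg0 : g = 0
  · subst hg0
    rw [natDegree_mul hf0 hp] at hf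
    simpa using hf
  rw [natDegree_mul hf0 hp] at hf
  rw [natDegree_mul hg0 hp] at hg
  omega

theorem truncSpace_inf_smul_eq_bot {E : IntermediateField K L} {x : L} {α : Lˣ} {l : ℕ}
    (hl : 2 * l < Module.finrank E (IntermediateField.adjoin E {x})) {f₀ g₀ : E[X]}
    (hcop : IsCoprime f₀ g₀) (hf₀ : f₀.natDegree ≤ l) (hg₀ : g₀.natDegree ≤ l)
    (h₀ : aeval x f₀ = α * aeval x g₀) {j : ℕ} (hj : j < max f₀.natDegree g₀.natDegree)
    (C : Submodule K E) : truncSpace E x j C ⊓ α • truncSpace E x j C = ⊥ := by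
  rw [eq_bot_iff]
  intro y hy
  simp only [mem_inf_smul, mem_truncSpace] at hy
  obtain ⟨⟨f, ⟨hf, -⟩, rfl⟩, _, ⟨g, ⟨hg, -⟩, rfl⟩, h⟩ := hy
  obtain ⟨p, rfl, rfl⟩ := exists_mul_of_ratio_eq hl hcop hf₀ hg₀ h₀
    (hf.trans (by omega)) (hg.trans (by omega)) h.symm
  by_cases hp : p = 0
  · simp [hp]
  · have := natDegree_add_max_le hp hcop.ne_zero_or_ne_zero hf hg
    omega

/-- The intersection is f₀(x) times a truncated space of degree k: the coefficient of degree m + k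
in f₀p is the product of those of degrees m and k, so both conditions on top coefficients become
conditions on p alone. -/
theorem natCard_truncSpace_inf_smul {E : IntermediateField K L} {x : L} {α : Lˣ} {l : ℕ}
    (hl : 2 * l < Module.finrank E (IntermediateField.adjoin E {x})) {f₀ g₀ : E[X]}
    (hcop : IsCoprime f₀ g₀) (hf₀ : f₀.natDegree ≤ l) (hg₀ : g₀.natDegree ≤ l)
    (h₀ : aeval x f₀ = α * aeval x g₀) {m k : ℕ} (hm : m = max f₀.natDegree g₀.natDegree)
    (hk : m + k ≤ l) (C : Submodule K E) :
    Nat.card (truncSpace E x (m + k) C ⊓ α • truncSpace E x (m + k) C : Submodule K L) =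
      Nat.card E ^ k * Nat.card (mulPreimage C (f₀.coeff m) (g₀.coeff m)) := by
  have hf₀m : f₀.natDegree ≤ m := by omega
  have hg₀m : g₀.natDegree ≤ m := by omega
  have hne : aeval x f₀ ≠ 0 := by
    intro h
    have hf0 := aeval_eq_zero_of_natDegree_lt (x := x) (by omega) h
    have hg0 : g₀ = 0 :=
      aeval_eq_zero_of_natDegree_lt (x := x) (by omega) (by simpa [h] using h₀.symm)
    simpa [hf0, hg0] using hcop.ne_zero_or_ne_zero
  rw [← natCard_truncSpace (x := x) (by omega)]
  have key : (truncSpace E x (m + k) C ⊓ α • truncSpace E x (m + k) C : Submodule K L) =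
      (truncSpace E x k (mulPreimage C (f₀.coeff m) (g₀.coeff m))).map
        (LinearMap.mulLeft K (aeval x f₀)) := by
    ext y
    simp only [mem_inf_smul, Submodule.mem_map, mem_truncSpace, mem_mulPreimage,
      LinearMap.mulLeft_apply]
    constructor
    · rintro ⟨⟨f, ⟨hf, hfC⟩, rfl⟩, _, ⟨g, ⟨hg, hgC⟩, rfl⟩, h⟩
      obtain ⟨p, rfl, rfl⟩ := exists_mul_of_ratio_eq hl hcop hf₀ hg₀ h₀
        (hf.trans (by omega)) (hg.trans (by omega)) h.symm
      have hp : p.natDegree ≤ k := by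
        by_cases hp : p = 0
        · simp [hp]
        · have := natDegree_add_max_le hp hcop.ne_zero_or_ne_zero hf hg
          omega
      rw [coeff_mul_add_eq_of_natDegree_le hf₀m hp] at hfC
      rw [coeff_mul_add_eq_of_natDegree_le hg₀m hp] at hgC
      exact ⟨_, ⟨p, ⟨hp, hfC, hgC⟩, rfl⟩, (map_mul _ _ _).symm⟩
    · rintro ⟨_, ⟨p, ⟨hp, hfC, hgC⟩, rfl⟩, rfl⟩
      rw [← coeff_mul_add_eq_of_natDegree_le hf₀m hp] at hfC
      rw [← coeff_mul_add_eq_of_natDegree_le hg₀m hp] at hgC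
      refine ⟨⟨f₀ * p, ⟨natDegree_mul_le_of_le hf₀m hp, hfC⟩, map_mul _ _ _⟩, _,
        ⟨g₀ * p, ⟨natDegree_mul_le_of_le hg₀m hp, hgC⟩, rfl⟩, ?_⟩
      rw [map_mul, ← mul_assoc, h₀]
  rw [key]
  exact (Nat.card_congr (Submodule.equivMapOfInjective _
    (mul_right_injective₀ hne) _).toEquiv).symm

/-- Either `α` is not a ratio of values of polynomials of degree at most `l`, or the sizes of all
intersections are governed by the degree `m` and the top coefficients `a`, `b` of a reduced
fraction. -/
theorem truncSpace_inf_smul_dichotomy {E : IntermediateField K L} {x : L} {l : ℕ}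
    (hl : 2 * l < Module.finrank E (IntermediateField.adjoin E {x})) (α : Lˣ) :
    (∀ j ≤ l, ∀ C : Submodule K E, truncSpace E x j C ⊓ α • truncSpace E x j C = ⊥) ∨
    ∃ m ≤ l, ∃ a b : E, (a ≠ 0 ∨ b ≠ 0) ∧ ∀ C : Submodule K E,
      (∀ j < m, truncSpace E x j C ⊓ α • truncSpace E x j C = ⊥) ∧
      ∀ k, m + k ≤ l →
        Nat.card (truncSpace E x (m + k) C ⊓ α • truncSpace E x (m + k) C : Submodule K L) =
          Nat.card E ^ k * Nat.card (mulPreimage C a b) := by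
  refine or_iff_not_imp_left.2 fun h => ?_
  push Not at h
  obtain ⟨j, hj, C, h⟩ := h
  obtain ⟨y, hy, hy0⟩ := Submodule.exists_mem_ne_zero_of_ne_bot h
  simp only [mem_inf_smul, mem_truncSpace] at hy
  obtain ⟨⟨f, ⟨hf, -⟩, rfl⟩, _, ⟨g, ⟨hg, -⟩, rfl⟩, h⟩ := hy
  have hf0 : f ≠ 0 := by
    rintro rfl
    simp at hy0
  classical
  have hd : EuclideanDomain.gcd f g ≠ 0 := fun h0 => hf0 (EuclideanDomain.gcd_eq_zero_iff.1 h0).1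
  obtain ⟨f₀, hf₀⟩ := EuclideanDomain.gcd_dvd_left f g
  obtain ⟨g₀, hg₀⟩ := EuclideanDomain.gcd_dvd_right f g
  set d := EuclideanDomain.gcd f g with hd_def
  have hcop : IsCoprime f₀ g₀ := by
    have := EuclideanDomain.gcd_eq_gcd_ab f g
    refine ⟨EuclideanDomain.gcdA f g, EuclideanDomain.gcdB f g, mul_left_cancel₀ hd ?_⟩
    rw [← hd_def] at this
    generalize EuclideanDomain.gcdA f g = u at *
    generalize EuclideanDomain.gcdB f g = v at *
    clear_value d
    subst hf₀
    subst hg₀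
    linear_combination -this
  have hfne : f₀ ≠ 0 := by
    rintro rfl
    exact hf0 (by simpa using hf₀)
  clear_value d
  subst hf₀
  subst hg₀
  have hdf := hf
  rw [natDegree_mul hd hfne] at hdf
  have hfl : f₀.natDegree ≤ l := by omega
  have hgl : g₀.natDegree ≤ l := by
    by_cases hg0 : g₀ = 0
    · simp [hg0]
    · rw [natDegree_mul hd hg0] at hg
      omega
  have h₀ : aeval x f₀ = α * aeval x g₀ := by
    have hdx : aeval x d ≠ 0 := fun h' =>
      hd (aeval_eq_zero_of_natDegree_lt (x := x) (by omega) h')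
    refine mul_left_cancel₀ hdx ?_
    rw [map_mul, map_mul] at h
    rw [← h]
    ring
  refine ⟨max f₀.natDegree g₀.natDegree, max_le hfl hgl, _, _, ?_, fun C =>
    ⟨fun j hj => truncSpace_inf_smul_eq_bot hl hcop hfl hgl h₀ hj C,
      fun k hk => natCard_truncSpace_inf_smul hl hcop hfl hgl h₀ rfl hk C⟩⟩
  rcases le_total g₀.natDegree f₀.natDegree with hle | hle
  · left
    rw [max_eq_left hle]
    simpa using hfne
  · rw [max_eq_right hle]
    -- The zero polynomial has `natDegree` 0, so here f₀ is a nonzero constant and supplies the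
    -- nonzero coefficient.
    by_cases hg0 : g₀ = 0
    · left
      rw [hg0] at hle ⊢
      rw [hle.antisymm' (by simp)]
      simpa using hfne
    · right
      simpa using hg0

end Intersections

/-! ### Double counting and orbit-stabilizer. -/

section Counting

variable {K L : Type*} [Field K] [Field L] [Algebra K L]

theorem natCard_submodule_sub_one [Finite L] [Fintype Lˣ] (T : Submodule K L)
    [DecidablePred fun u : Lˣ => (u : L) ∈ T] :
    (Nat.card T : ℤ) - 1 = ∑ u : Lˣ, if (u : L) ∈ T then 1 else 0 := by
  classical
  have := Fintype.ofFinite L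
  have h : ({y | y ∈ T} : Finset L) =
      insert 0 (({u : Lˣ | (u : L) ∈ T} : Finset Lˣ).map ⟨Units.val, Units.val_injective⟩) := by
    ext y
    by_cases hy : y = 0
    · simp [hy]
    · simp only [Finset.mem_filter, Finset.mem_univ, true_and, Finset.mem_insert, hy, false_or,
        Finset.mem_map, Function.Embedding.coeFn_mk]
      exact ⟨fun h => ⟨Units.mk0 y hy, h, rfl⟩, by rintro ⟨u, hu, rfl⟩; exact hu⟩
  have hc : Nat.card T = ({y | y ∈ T} : Finset L).card := by
    rw [Nat.card_eq_fintype_card]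
    exact Fintype.card_subtype (fun y : L => y ∈ T)
  rw [hc, h, Finset.card_insert_of_notMem (by simp), Finset.card_map, Finset.sum_boole]
  push_cast
  ring

/-- Both sides count pairs (u, v) of nonzero elements of S: a nonzero u ∈ S ∩ αS corresponds to the
pair with v = u/α. -/
theorem sum_natCard_inf_smul [Finite L] [Fintype Lˣ] (S : Submodule K L) :
    ∑ α : Lˣ, ((Nat.card (S ⊓ α • S : Submodule K L) : ℤ) - 1) = ((Nat.card S : ℤ) - 1) ^ 2 := by
  classical
  simp_rw [natCard_submodule_sub_one]
  rw [Finset.sum_comm, sq, Finset.sum_mul]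
  refine Finset.sum_congr rfl fun u _ => ?_
  rw [← Equiv.sum_comp (Equiv.divLeft u), Finset.mul_sum]
  refine Finset.sum_congr rfl fun v _ => ?_
  have : (u : L) ∈ S ⊓ (u / v) • S ↔ (u : L) ∈ S ∧ (v : L) ∈ S := by
    rw [mem_inf_smul]
    refine and_congr_right fun _ => ⟨?_, fun h => ⟨v, h, ?_⟩⟩
    · rintro ⟨z, hz, h⟩
      have hzv : z = v := by
        rw [Units.val_div_eq_div_val] at h
        field_simp at h
        exact h
      rwa [← hzv]
    · rw [← Units.val_mul, div_mul_cancel]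
  simp only [Equiv.divLeft_apply, this]
  split_ifs <;> simp_all

/-- The number of multipliers with a given property of the codeword is the size of the
stabilizer times the number of codewords with this property. -/
theorem ncard_smul_eq_stabilizer_mul [Finite L] (S : Submodule K L)
    (P : Submodule K L → Prop) :
    {α : Lˣ | P (α • S)}.ncard =
      {α : Lˣ | α • S = S}.ncard * {T : Submodule K L | T ∈ cyclicOrbit S ∧ P T}.ncard := by
  classical
  have := Fintype.ofFinite Lˣ
  have hT : {T : Submodule K L | T ∈ cyclicOrbit S ∧ P T} =
      (({α | P (α • S)} : Finset Lˣ).image (· • S) : Finset (Submodule K L)) := by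
    ext T
    simp only [cyclicOrbit, MulAction.mem_orbit_iff, Set.mem_ofPred_eq, Finset.coe_image,
      Finset.coe_filter, Finset.mem_univ, true_and, Set.mem_image]
    constructor
    · rintro ⟨⟨α, rfl⟩, h⟩
      exact ⟨α, h, rfl⟩
    · rintro ⟨α, h, rfl⟩
      exact ⟨⟨α, rfl⟩, h⟩
  have h1 (p : Lˣ → Prop) : {α : Lˣ | p α}.ncard = ({α | p α} : Finset Lˣ).card := by
    rw [← Set.ncard_coe_finset]
    simp
  rw [hT, Set.ncard_coe_finset, h1, h1, mul_comm,
    Finset.card_eq_sum_card_image (fun α : Lˣ => α • S)]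
  refine Finset.sum_const_nat fun T hT => ?_
  obtain ⟨β, hβ, rfl⟩ := Finset.mem_image.1 hT
  have hβ' : P (β • S) := by simpa using hβ
  -- The fibre over `β • S` is the coset of the stabilizer containing β.
  refine Finset.card_nbij' (β⁻¹ * ·) (β * ·) ?_ ?_ (fun _ _ => mul_inv_cancel_left _ _)
    (fun _ _ => inv_mul_cancel_left _ _)
  · intro α hα
    simp only [Finset.coe_filter, Finset.mem_filter, Finset.mem_univ, true_and,
      Set.mem_ofPred_eq] at hα ⊢
    rw [mul_smul, hα.2, inv_smul_smul]
  · intro α hα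
    simp only [Finset.coe_filter, Finset.mem_filter, Finset.mem_univ, true_and,
      Set.mem_ofPred_eq] at hα ⊢
    rw [mul_smul, hα]
    exact ⟨hβ', rfl⟩

end Counting

/-! ### Sizes of the intersections for C = 0 and C = K. -/

section Classification

variable {K L : Type*} [Field K] [Field L] [Algebra K L]

/-- The size of the intersection of `truncSpace E x j C` with its multiple by `α`. -/
noncomputable def meetCard (E : IntermediateField K L) (x : L) (C : Submodule K E) (j : ℕ)
    (α : Lˣ) : ℕ :=
  Nat.card (truncSpace E x j C ⊓ α • truncSpace E x j C : Submodule K L)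

theorem natCard_mulPreimage_bot {E : IntermediateField K L} {a b : E} (h : a ≠ 0 ∨ b ≠ 0) :
    Nat.card (mulPreimage (⊥ : Submodule K E) a b) = 1 := by
  have : mulPreimage (⊥ : Submodule K E) a b = ⊥ := by
    rw [eq_bot_iff]
    intro c hc
    simp only [mem_mulPreimage, Submodule.mem_bot, mul_eq_zero] at hc
    rw [Submodule.mem_bot]
    tauto
  rw [this]
  simp

/-- If a ≠ 0, then ac ∈ K confines c to the line K a⁻¹, and likewise for b. -/
theorem natCard_mulPreimage_span_one {E : IntermediateField K L} [Finite K] {a b : E}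
    (h : a ≠ 0 ∨ b ≠ 0) :
    Nat.card (mulPreimage (Submodule.span K {(1 : E)}) a b) = 1 ∨
    Nat.card (mulPreimage (Submodule.span K {(1 : E)}) a b) = Nat.card K := by
  have key (a : E) (ha : a ≠ 0) (U : Submodule K E)
      (hU : U ≤ (Submodule.span K {(1 : E)}).comap (LinearMap.mulLeft K a)) :
      Nat.card U = 1 ∨ Nat.card U = Nat.card K := by
    have hle : U ≤ Submodule.span K {a⁻¹} := by
      intro c hc
      obtain ⟨d, hd⟩ := Submodule.mem_span_singleton.1 (hU hc)
      refine Submodule.mem_span_singleton.2 ⟨d, ?_⟩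
      rw [LinearMap.mulLeft_apply] at hd
      rw [← one_mul a⁻¹, ← smul_mul_assoc, hd]
      field_simp
    have h1 : Module.finrank K U ≤ 1 :=
      (Submodule.finrank_mono hle).trans (finrank_span_singleton (inv_ne_zero ha)).le
    have : FiniteDimensional K U := Submodule.finiteDimensional_of_le hle
    rw [Module.natCard_eq_pow_finrank (K := K)]
    interval_cases Module.finrank K U <;> simp
  rcases h with h | h
  · exact key a h _ inf_le_left
  · exact key b h _ inf_le_right

theorem meetCard_classification [Finite K] [FiniteDimensional K L] {E : IntermediateField K L}
    {x : L} {l : ℕ} (hl : 2 * l < Module.finrank E (IntermediateField.adjoin E {x})) (α : Lˣ) :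
    (∀ j ≤ l, meetCard E x ⊥ j α = 1 ∧ meetCard E x (Submodule.span K {1}) j α = 1) ∨
    ∃ m ≤ l, ∃ e, (e = 1 ∨ e = Nat.card K) ∧
      (∀ j < m, meetCard E x ⊥ j α = 1 ∧ meetCard E x (Submodule.span K {1}) j α = 1) ∧
      ∀ k, m + k ≤ l → meetCard E x ⊥ (m + k) α = Nat.card E ^ k ∧
        meetCard E x (Submodule.span K {1}) (m + k) α = Nat.card E ^ k * e := by
  unfold meetCard
  rcases truncSpace_inf_smul_dichotomy hl α with h | ⟨m, hm, a, b, hab, h⟩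
  · left
    intro j hj
    rw [h j hj, h j hj]
    simp
  · refine Or.inr ⟨m, hm, _, natCard_mulPreimage_span_one hab, fun j hj => ?_, fun k hk => ?_⟩
    · rw [(h _).1 j hj, (h _).1 j hj]
      simp
    · rw [(h _).2 k hk, (h _).2 k hk, natCard_mulPreimage_bot hab]
      simp

end Classification

/-! ### Counting multipliers by recurrences in the degree. -/

section WeightCounts

variable {K L : Type*} [Field K] [Field L] [Algebra K L]

theorem cast_ncard_eq_sum {ι : Type*} [Fintype ι] (p : ι → Prop) [DecidablePred p] :
    ({i | p i}.ncard : ℤ) = ∑ i, if p i then 1 else 0 := by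
  rw [Finset.sum_boole, ← Set.ncard_coe_finset]
  simp

variable [Finite L] {E : IntermediateField K L} {x : L} {l : ℕ}

theorem sum_meetCard_sub_one [Fintype Lˣ] {j : ℕ}
    (hj : j < Module.finrank E (IntermediateField.adjoin E {x})) (C : Submodule K E) :
    ∑ α : Lˣ, ((meetCard E x C j α : ℤ) - 1) =
      ((Nat.card E : ℤ) ^ j * Nat.card C - 1) ^ 2 := by
  have : FiniteDimensional K L := Module.Finite.of_finite
  unfold meetCard
  rw [sum_natCard_inf_smul, natCard_truncSpace hj]
  push_cast
  rfl

theorem natCard_span_one [Finite K] :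
    Nat.card (Submodule.span K {(1 : E)}) = Nat.card K := by
  have : FiniteDimensional K L := Module.Finite.of_finite
  rw [Module.natCard_eq_pow_finrank (K := K), finrank_span_singleton one_ne_zero, pow_one]

theorem meetCard_bot_zero (α : Lˣ) : meetCard E x ⊥ 0 α = 1 := by
  have : FiniteDimensional K L := Module.Finite.of_finite
  have h : truncSpace E x 0 ⊥ = ⊥ := by
    rw [eq_bot_iff]
    intro y hy
    obtain ⟨f, ⟨hf, hf'⟩, rfl⟩ := mem_truncSpace.1 hy
    rw [Submodule.mem_bot] at hf'
    rw [eq_C_of_natDegree_le_zero hf, hf']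
    simp
  simp [meetCard, h]

variable [Finite K]

/-- The size is 1 up to degree m and is then multiplied by q² at each step. Hence the left side is
q² - 1 exactly when m ≤ j, and 0 otherwise. -/
theorem meetCard_bot_succ (hl : 2 * l < Module.finrank E (IntermediateField.adjoin E {x}))
    {q : ℕ} (hq : Nat.card K = q) (hE : Nat.card E = q ^ 2) {j : ℕ} (hj : j + 1 ≤ l) (α : Lˣ) :
    ((meetCard E x ⊥ (j + 1) α : ℤ) - 1) - (q : ℤ) ^ 2 * (meetCard E x ⊥ j α - 1) =
      ((q : ℤ) ^ 2 - 1) * if meetCard E x ⊥ (j + 1) α ≠ 1 then 1 else 0 := by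
  have hq1 : 1 < q := hq ▸ Finite.one_lt_card
  have : FiniteDimensional K L := Module.Finite.of_finite
  rcases meetCard_classification hl α with h | ⟨m, hm, e, he, h1, h2⟩
  · simp [(h (j + 1) hj).1, (h j (by omega)).1]
  rw [hq] at he
  rw [hE] at h2
  rcases lt_trichotomy (j + 1) m with hjm | rfl | hjm
  · simp [(h1 (j + 1) hjm).1, (h1 j (by omega)).1]
  · have h3 := (h2 0 hm).1
    rw [add_zero, pow_zero] at h3
    simp [h3, (h1 j (by omega)).1]
  · obtain ⟨k, rfl⟩ := Nat.exists_eq_add_of_le (Nat.lt_succ_iff.1 hjm)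
    have h3 : (q ^ 2) ^ (k + 1) ≠ 1 :=
      (Nat.one_lt_pow (by omega) (Nat.one_lt_pow (by omega) hq1)).ne'
    rw [add_assoc, (h2 (k + 1) hj).1, (h2 k (by omega)).1, if_pos h3]
    push_cast
    ring

/-- For C = K the size jumps from 1 to e at degree m, which adds e - 1 when m = j + 1. The second
indicator selects precisely m = j + 1, e = q. -/
theorem meetCard_span_one_succ
    (hl : 2 * l < Module.finrank E (IntermediateField.adjoin E {x}))
    {q : ℕ} (hq : Nat.card K = q) (hE : Nat.card E = q ^ 2) {j : ℕ} (hj : j + 1 ≤ l) (α : Lˣ) :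
    ((meetCard E x (Submodule.span K {1}) (j + 1) α : ℤ) - 1) -
        (q : ℤ) ^ 2 * (meetCard E x (Submodule.span K {1}) j α - 1) =
      ((q : ℤ) ^ 2 - 1) * (if meetCard E x ⊥ (j + 1) α ≠ 1 then 1 else 0) +
      ((q : ℤ) - 1) * (if meetCard E x (Submodule.span K {1}) (j + 1) α ≠ 1 ∧
        meetCard E x ⊥ (j + 1) α = 1 then 1 else 0) := by
  have hq1 : 1 < q := hq ▸ Finite.one_lt_card
  have : FiniteDimensional K L := Module.Finite.of_finite
  rcases meetCard_classification hl α with h | ⟨m, hm, e, he, h1, h2⟩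
  · simp [(h (j + 1) hj).1, (h (j + 1) hj).2, (h j (by omega)).2]
  rw [hq] at he
  rw [hE] at h2
  rcases lt_trichotomy (j + 1) m with hjm | rfl | hjm
  · simp [(h1 (j + 1) hjm).1, (h1 (j + 1) hjm).2, (h1 j (by omega)).2]
  · have h3 := h2 0 hm
    rw [add_zero, pow_zero, one_mul] at h3
    rw [h3.1, h3.2, (h1 j (by omega)).2]
    rcases he with rfl | rfl
    · simp
    · simp [hq1.ne']
  · obtain ⟨k, rfl⟩ := Nat.exists_eq_add_of_le (Nat.lt_succ_iff.1 hjm)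
    have h3 : (q ^ 2) ^ (k + 1) ≠ 1 :=
      (Nat.one_lt_pow (by omega) (Nat.one_lt_pow (by omega) hq1)).ne'
    rw [add_assoc, (h2 (k + 1) hj).1, (h2 (k + 1) hj).2, (h2 k (by omega)).2, if_pos h3,
      if_neg (by tauto)]
    push_cast
    ring

theorem meetCard_span_one_zero
    (hl : 2 * l < Module.finrank E (IntermediateField.adjoin E {x}))
    {q : ℕ} (hq : Nat.card K = q) (α : Lˣ) :
    (meetCard E x (Submodule.span K {1}) 0 α : ℤ) - 1 =
      ((q : ℤ) - 1) * if meetCard E x (Submodule.span K {1}) 0 α ≠ 1 then 1 else 0 := by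
  have hq1 : 1 < q := hq ▸ Finite.one_lt_card
  have : FiniteDimensional K L := Module.Finite.of_finite
  rcases meetCard_classification hl α with h | ⟨m, hm, e, he, h1, h2⟩
  · simp [(h 0 (by omega)).2]
  rw [hq] at he
  rcases Nat.eq_zero_or_pos m with rfl | hm0
  · have h3 := (h2 0 hm).2
    rw [add_zero, pow_zero, one_mul] at h3
    rw [h3]
    rcases he with rfl | rfl
    · simp
    · simp [hq1.ne']
  · simp [(h1 0 hm0).2]

/-- The multipliers whose reduced fraction has degree less than `j`. -/
theorem ncard_meetCard_bot (hl : 2 * l < Module.finrank E (IntermediateField.adjoin E {x}))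
    {q : ℕ} (hq : Nat.card K = q) (hE : Nat.card E = q ^ 2) {j : ℕ} (hj : j + 1 ≤ l) :
    ({α : Lˣ | meetCard E x ⊥ (j + 1) α ≠ 1}.ncard : ℤ) = (q : ℤ) ^ (4 * j + 2) - 1 := by
  have := Fintype.ofFinite Lˣ
  have hq1 : 1 < q := hq ▸ Finite.one_lt_card
  have hq2 : ((q : ℤ) ^ 2 - 1) ≠ 0 := by
    have : (1 : ℤ) < q := by exact_mod_cast hq1
    nlinarith
  rw [cast_ncard_eq_sum]
  refine mul_left_cancel₀ hq2 ?_
  -- The total is (q^(2j+2) - 1)² - q²(q^(2j) - 1)² = (q² - 1)(q^(4j+2) - 1).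
  rw [Finset.mul_sum, ← Finset.sum_congr rfl fun α _ => meetCard_bot_succ hl hq hE hj α,
    Finset.sum_sub_distrib, ← Finset.mul_sum, sum_meetCard_sub_one (by omega),
    sum_meetCard_sub_one (by omega), hE]
  simp
  ring

/-- The multipliers whose reduced fraction has degree `j + 1` and top coefficients proportional
over `K`. -/
theorem ncard_meetCard_span_one_succ
    (hl : 2 * l < Module.finrank E (IntermediateField.adjoin E {x}))
    {q : ℕ} (hq : Nat.card K = q) (hE : Nat.card E = q ^ 2) {j : ℕ} (hj : j + 1 ≤ l) :
    ({α : Lˣ | meetCard E x (Submodule.span K {1}) (j + 1) α ≠ 1 ∧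
      meetCard E x ⊥ (j + 1) α = 1}.ncard : ℤ) =
      (q : ℤ) ^ (4 * j + 2) * (q - 1) * (q + 1) ^ 2 := by
  have := Fintype.ofFinite Lˣ
  have hq1 : 1 < q := hq ▸ Finite.one_lt_card
  have hq2 : ((q : ℤ) - 1) ≠ 0 := by
    have : (1 : ℤ) < q := by exact_mod_cast hq1
    linarith
  have h1 := ncard_meetCard_bot hl hq hE hj
  rw [cast_ncard_eq_sum] at h1 ⊢
  have h2 := Finset.sum_congr (rfl : (Finset.univ : Finset Lˣ) = _)
    fun α _ => meetCard_span_one_succ hl hq hE hj α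
  rw [Finset.sum_sub_distrib, ← Finset.mul_sum, sum_meetCard_sub_one (by omega),
    sum_meetCard_sub_one (by omega), hE, Finset.sum_add_distrib, ← Finset.mul_sum,
    ← Finset.mul_sum, h1, natCard_span_one, hq] at h2
  refine mul_left_cancel₀ hq2 ?_
  push_cast at h2
  -- (q^(2j+3) - 1)² - q²(q^(2j+1) - 1)² - (q² - 1)(q^(4j+2) - 1) = q^(4j+2)(q² - 1)².
  linear_combination -h2

theorem ncard_meetCard_span_one_zero
    (hl : 2 * l < Module.finrank E (IntermediateField.adjoin E {x}))
    {q : ℕ} (hq : Nat.card K = q) :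
    ({α : Lˣ | meetCard E x (Submodule.span K {1}) 0 α ≠ 1}.ncard : ℤ) = q - 1 := by
  have := Fintype.ofFinite Lˣ
  have hq1 : 1 < q := hq ▸ Finite.one_lt_card
  have hq2 : ((q : ℤ) - 1) ≠ 0 := by
    have : (1 : ℤ) < q := by exact_mod_cast hq1
    linarith
  rw [cast_ncard_eq_sum]
  refine mul_left_cancel₀ hq2 ?_
  rw [Finset.mul_sum, ← Finset.sum_congr rfl fun α _ => meetCard_span_one_zero hl hq α,
    sum_meetCard_sub_one (by omega), natCard_span_one, hq]
  ring

end WeightCounts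

/-! ### From intersection sizes to distances. -/

section Distances

variable {K L : Type*} [Field K] [Field L] [Algebra K L]

theorem finrank_units_smul (S : Submodule K L) (α : Lˣ) :
    Module.finrank K (α • S : Submodule K L) = Module.finrank K S := by
  have h : α • S = S.map (LinearMap.mulLeft K (α : L)) := by
    change (α : L) • S = _
    ext y
    rw [Submodule.mem_smul_pointwise_iff_exists]
    rfl
  rw [h]
  exact (Submodule.equivMapOfInjective _ (mul_right_injective₀ α.ne_zero) S).finrank_eq.symm

theorem natCard_pow_succ_ne_one [Finite K] {E : IntermediateField K L}
    (hE : Nat.card E = Nat.card K ^ 2) (k : ℕ) :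
    Nat.card E ^ (k + 1) ≠ 1 := by
  rw [hE, ← pow_mul]
  exact (Nat.one_lt_pow (by omega) Finite.one_lt_card).ne'

variable [Finite L] {E : IntermediateField K L} {x : L} {l : ℕ}

theorem disjoint_powerSpan (hl : 2 * l < Module.finrank E (IntermediateField.adjoin E {x})) :
    Disjoint (powerSpan E x l) (Submodule.span K {x ^ l}) := by
  have : FiniteDimensional K L := Module.Finite.of_finite
  rw [Submodule.disjoint_def]
  intro y hy hy'
  obtain ⟨f, hf, rfl⟩ := mem_powerSpan.1 hy
  obtain ⟨c, hc⟩ := Submodule.mem_span_singleton.1 hy'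
  rw [mem_degreeLT] at hf
  have h : f = C (c • (1 : E)) * X ^ l := by
    refine aeval_injOn_of_natDegree_lt (x := x) ?_ ?_ ?_
    · exact (natDegree_le_of_degree_le hf.le).trans_lt (by omega)
    · exact (natDegree_C_mul_X_pow_le _ _).trans_lt (by omega)
    · rw [← hc, map_mul, aeval_C, map_pow, aeval_X, algebraMap_smul_one_mul]
  have h0 : c • (1 : E) = 0 := by
    have := congrArg (coeff · l) h
    simpa [coeff_eq_zero_of_degree_lt hf] using this.symm
  rw [h, h0]
  simp

theorem natCard_pow_finrank_fwsSpace_inf_smul (α : Lˣ) :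
    Nat.card K ^ Module.finrank K (fwsSpace E x l ⊓ α • fwsSpace E x l : Submodule K L) =
      meetCard E x (Submodule.span K {1}) l α := by
  have : FiniteDimensional K L := Module.Finite.of_finite
  rw [← Module.natCard_eq_pow_finrank, fwsSpace_eq_truncSpace, meetCard]

variable [Finite K]

theorem finrank_fwsSpace (hl : 2 * l < Module.finrank E (IntermediateField.adjoin E {x}))
    (hE : Nat.card E = Nat.card K ^ 2) : Module.finrank K (fwsSpace E x l) = 2 * l + 1 := by
  have : FiniteDimensional K L := Module.Finite.of_finite
  refine Nat.pow_right_injective (Finite.one_lt_card (α := K)) ?_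
  change Nat.card K ^ _ = Nat.card K ^ _
  rw [← Module.natCard_eq_pow_finrank, fwsSpace_eq_truncSpace, natCard_truncSpace (by omega),
    natCard_span_one, hE, ← pow_mul, ← pow_succ]

theorem subspaceDist_fwsSpace (hl : 2 * l < Module.finrank E (IntermediateField.adjoin E {x}))
    (hE : Nat.card E = Nat.card K ^ 2) (α : Lˣ) :
    subspaceDist (fwsSpace E x l) (α • fwsSpace E x l) =
      4 * l + 2 - 2 * Module.finrank K (fwsSpace E x l ⊓ α • fwsSpace E x l : Submodule K L) := by
  rw [subspaceDist, finrank_units_smul, finrank_fwsSpace hl hE]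
  congr 1
  ring

theorem smul_fwsSpace_eq_iff (hl : 2 * l < Module.finrank E (IntermediateField.adjoin E {x}))
    (hE : Nat.card E = Nat.card K ^ 2) (α : Lˣ) :
    α • fwsSpace E x l = fwsSpace E x l ↔
      subspaceDist (fwsSpace E x l) (α • fwsSpace E x l) = 0 := by
  have : FiniteDimensional K L := Module.Finite.of_finite
  have hS := finrank_fwsSpace hl hE
  rw [subspaceDist_fwsSpace hl hE]
  constructor
  · intro h
    rw [h, inf_idem, hS]
    omega
  · intro h
    have h1 : fwsSpace E x l ⊓ α • fwsSpace E x l = fwsSpace E x l :=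
      Submodule.eq_of_le_of_finrank_le inf_le_left (by omega)
    exact (Submodule.eq_of_le_of_finrank_eq (inf_eq_left.1 h1)
      (finrank_units_smul _ _).symm).symm

/-- The distance is determined by the degree and the top coefficients of the reduced fraction. -/
theorem subspaceDist_classification
    (hl : 2 * l < Module.finrank E (IntermediateField.adjoin E {x}))
    (hE : Nat.card E = Nat.card K ^ 2) (α : Lˣ) :
    ((∀ j ≤ l, meetCard E x ⊥ j α = 1 ∧ meetCard E x (Submodule.span K {1}) j α = 1) ∧
      subspaceDist (fwsSpace E x l) (α • fwsSpace E x l) = 4 * l + 2) ∨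
    ∃ m ≤ l, ∃ e,
      (e = 1 ∧ subspaceDist (fwsSpace E x l) (α • fwsSpace E x l) = 4 * m + 2 ∨
        e = Nat.card K ∧ subspaceDist (fwsSpace E x l) (α • fwsSpace E x l) = 4 * m) ∧
      (∀ j < m, meetCard E x ⊥ j α = 1 ∧ meetCard E x (Submodule.span K {1}) j α = 1) ∧
      ∀ k, m + k ≤ l → meetCard E x ⊥ (m + k) α = Nat.card E ^ k ∧
        meetCard E x (Submodule.span K {1}) (m + k) α = Nat.card E ^ k * e := by
  have : FiniteDimensional K L := Module.Finite.of_finite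
  have hinj := Nat.pow_right_injective (Finite.one_lt_card (α := K))
  have hD := natCard_pow_finrank_fwsSpace_inf_smul (E := E) (x := x) (l := l) α
  rw [subspaceDist_fwsSpace hl hE]
  rcases meetCard_classification hl α with h | ⟨m, hm, e, he, h1, h2⟩
  · refine Or.inl ⟨h, ?_⟩
    rw [(h l le_rfl).2, ← pow_zero (Nat.card K)] at hD
    rw [hinj hD]
    rfl
  · refine Or.inr ⟨m, hm, e, ?_, h1, h2⟩
    obtain ⟨k, rfl⟩ := Nat.exists_eq_add_of_le hm
    rw [(h2 k le_rfl).2, hE, ← pow_mul] at hD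
    refine he.imp (fun he => ⟨he, ?_⟩) (fun he => ⟨he, ?_⟩)
    · rw [he, mul_one] at hD
      rw [hinj hD]
      omega
    · rw [he, ← pow_succ] at hD
      rw [hinj hD]
      omega

/-- Since the distance is 4m or 4m + 2, both sides say m < r; when α is not a ratio, both fail. -/
theorem subspaceDist_lt_iff (hl : 2 * l < Module.finrank E (IntermediateField.adjoin E {x}))
    (hE : Nat.card E = Nat.card K ^ 2) (α : Lˣ) {r : ℕ} (hr : r ≤ l) :
    subspaceDist (fwsSpace E x l) (α • fwsSpace E x l) < 4 * r ↔ meetCard E x ⊥ r α ≠ 1 := by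
  rcases subspaceDist_classification hl hE α with ⟨h, hd⟩ | ⟨m, hm, e, he, h1, h2⟩
  · rw [hd, (h r hr).1]
    omega
  · rcases lt_or_ge r m with hrm | hrm
    · rw [(h1 r hrm).1]
      omega
    · obtain ⟨k, rfl⟩ := Nat.exists_eq_add_of_le hrm
      rw [(h2 k hr).1]
      rcases k with _ | k
      · rw [pow_zero]
        omega
      · have := natCard_pow_succ_ne_one hE k
        omega

/-- Both sides say m = r and e = q. -/
theorem subspaceDist_eq_iff (hl : 2 * l < Module.finrank E (IntermediateField.adjoin E {x}))
    (hE : Nat.card E = Nat.card K ^ 2) (α : Lˣ) {r : ℕ} (hr : r ≤ l) :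
    subspaceDist (fwsSpace E x l) (α • fwsSpace E x l) = 4 * r ↔
      meetCard E x (Submodule.span K {1}) r α ≠ 1 ∧ meetCard E x ⊥ r α = 1 := by
  have hK := Finite.one_lt_card (α := K)
  rcases subspaceDist_classification hl hE α with ⟨h, hd⟩ | ⟨m, hm, e, he, h1, h2⟩
  · rw [hd, (h r hr).1, (h r hr).2]
    omega
  · rcases lt_or_ge r m with hrm | hrm
    · rw [(h1 r hrm).1, (h1 r hrm).2]
      omega
    · obtain ⟨k, rfl⟩ := Nat.exists_eq_add_of_le hrm
      rw [(h2 k hr).1, (h2 k hr).2]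
      rcases k with _ | k
      · rw [pow_zero, one_mul]
        omega
      · have := natCard_pow_succ_ne_one hE k
        omega

end Distances

/-! ### Numbers of multipliers and of codewords at each distance. -/

section WeightDistribution

variable {K L : Type*} [Field K] [Field L] [Algebra K L] [Finite K] [Finite L]
  {E : IntermediateField K L} {x : L} {l q : ℕ}

theorem ncard_subspaceDist_lt (hl : 2 * l < Module.finrank E (IntermediateField.adjoin E {x}))
    (hq : Nat.card K = q) (hE : Nat.card E = q ^ 2) {r : ℕ} (hr : r + 1 ≤ l) :
    ({α : Lˣ | subspaceDist (fwsSpace E x l) (α • fwsSpace E x l) < 4 * (r + 1)}.ncard : ℤ) =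
      (q : ℤ) ^ (4 * r + 2) - 1 := by
  simp_rw [subspaceDist_lt_iff hl (hq ▸ hE) _ hr]
  exact ncard_meetCard_bot hl hq hE hr

theorem ncard_subspaceDist_four_mul_succ
    (hl : 2 * l < Module.finrank E (IntermediateField.adjoin E {x}))
    (hq : Nat.card K = q) (hE : Nat.card E = q ^ 2) {r : ℕ} (hr : r + 1 ≤ l) :
    ({α : Lˣ | subspaceDist (fwsSpace E x l) (α • fwsSpace E x l) = 4 * (r + 1)}.ncard : ℤ) =
      (q : ℤ) ^ (4 * r + 2) * (q - 1) * (q + 1) ^ 2 := by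
  simp_rw [subspaceDist_eq_iff hl (hq ▸ hE) _ hr]
  exact ncard_meetCard_span_one_succ hl hq hE hr

theorem ncard_subspaceDist_zero
    (hl : 2 * l < Module.finrank E (IntermediateField.adjoin E {x}))
    (hq : Nat.card K = q) (hE : Nat.card E = q ^ 2) :
    ({α : Lˣ | subspaceDist (fwsSpace E x l) (α • fwsSpace E x l) = 0}.ncard : ℤ) = q - 1 := by
  rw [← ncard_meetCard_span_one_zero hl hq]
  congr 2
  ext α
  have := subspaceDist_eq_iff hl (hq ▸ hE) α (Nat.zero_le l)
  rw [mul_zero] at this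
  simp [this, meetCard_bot_zero]

/-- Multipliers counted by distance: those below `4 (r + 1)` have distance below `4 r`, or `4 r`,
or `4 r + 2`. -/
theorem ncard_subspaceDist_add (hl : 2 * l < Module.finrank E (IntermediateField.adjoin E {x}))
    (hE : Nat.card E = Nat.card K ^ 2) (r : ℕ) :
    ({α : Lˣ | subspaceDist (fwsSpace E x l) (α • fwsSpace E x l) < 4 * (r + 1)}.ncard : ℤ) =
      {α : Lˣ | subspaceDist (fwsSpace E x l) (α • fwsSpace E x l) < 4 * r}.ncard +
      {α : Lˣ | subspaceDist (fwsSpace E x l) (α • fwsSpace E x l) = 4 * r}.ncard +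
      {α : Lˣ | subspaceDist (fwsSpace E x l) (α • fwsSpace E x l) = 4 * r + 2}.ncard := by
  have := Fintype.ofFinite Lˣ
  simp_rw [cast_ncard_eq_sum]
  rw [← Finset.sum_add_distrib, ← Finset.sum_add_distrib]
  refine Finset.sum_congr rfl fun α _ => ?_
  -- This formula makes every distance even, which excludes 4r + 1 and 4r + 3.
  have := subspaceDist_fwsSpace hl hE α
  split_ifs <;> omega

theorem ncard_units_subspaceDist_lt
    (hl : 2 * l < Module.finrank E (IntermediateField.adjoin E {x}))
    (hE : Nat.card E = Nat.card K ^ 2) :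
    ({α : Lˣ | subspaceDist (fwsSpace E x l) (α • fwsSpace E x l) < 4 * (l + 1)}.ncard : ℤ) =
      Nat.card L - 1 := by
  have h : {α : Lˣ | subspaceDist (fwsSpace E x l) (α • fwsSpace E x l) < 4 * (l + 1)} =
      Set.univ := by
    refine Set.eq_univ_of_forall fun α => ?_
    have := subspaceDist_fwsSpace hl hE α
    rw [Set.mem_ofPred_eq]
    omega
  rw [h, Set.ncard_univ, Nat.card_units, Nat.cast_sub Nat.card_pos]
  rfl

/-- The stabilizer of S is the set of multipliers at distance 0, already counted as q - 1. -/
theorem ncard_subspaceDist_eq (hl : 2 * l < Module.finrank E (IntermediateField.adjoin E {x}))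
    (hq : Nat.card K = q) (hE : Nat.card E = q ^ 2) (w : ℕ) :
    ({α : Lˣ | subspaceDist (fwsSpace E x l) (α • fwsSpace E x l) = w}.ncard : ℤ) =
      (q - 1) * orbitWeight (fwsSpace E x l) w := by
  rw [orbitWeight, ncard_smul_eq_stabilizer_mul (fwsSpace E x l)
    (subspaceDist (fwsSpace E x l) · = w)]
  push_cast
  rw [← ncard_subspaceDist_zero hl hq hE]
  simp_rw [smul_fwsSpace_eq_iff hl (hq ▸ hE)]

theorem natCard_sub_one_eq_mul_ncard_cyclicOrbit
    (hl : 2 * l < Module.finrank E (IntermediateField.adjoin E {x}))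
    (hq : Nat.card K = q) (hE : Nat.card E = q ^ 2) :
    (Nat.card L : ℤ) - 1 = (q - 1) * (cyclicOrbit (fwsSpace E x l)).ncard := by
  have h := ncard_smul_eq_stabilizer_mul (fwsSpace E x l) fun _ => True
  simp only [and_true, Set.ofPred_true, Set.ncard_univ, Nat.card_units, Set.ofPred_mem_eq] at h
  rw [← ncard_subspaceDist_zero hl hq hE]
  simp_rw [← smul_fwsSpace_eq_iff hl (hq ▸ hE)]
  rw [← Nat.cast_mul, ← h, Nat.cast_sub Nat.card_pos]
  rfl

end WeightDistribution

/-! ### The weight distribution. -/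

theorem mainTheorem1 {K L : Type*} [Field K] [Field L] [Algebra K L] [Finite K] [Finite L]
    (q n t l : ℕ) (hq : Nat.card K = q) (hn : Module.finrank K L = n) (hn_even : Even n)
    (E : IntermediateField K L) (hE : Module.finrank K E = 2)
    (lam : L) (hlam : lam ∉ E)
    (ht : Module.finrank E (IntermediateField.adjoin E {lam}) = t)
    (hl : 1 ≤ l) (hlt : (l : ℚ) < (t : ℚ) / 2) :
    Disjoint (powerSpan E lam l) (Submodule.span K {lam ^ l}) ∧
    Module.finrank K (fwsSpace E lam l) = 2 * l + 1 ∧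
    ((cyclicOrbit (fwsSpace E lam l)).ncard : ℚ) = ((q : ℚ) ^ n - 1) / ((q : ℚ) - 1) ∧
    orbitWeight (fwsSpace E lam l) 2 = q ∧
    (∀ r : ℕ, 1 ≤ r → r ≤ l - 1 →
      (orbitWeight (fwsSpace E lam l) (4 * r + 2) : ℚ) =
        (q : ℚ) ^ (4 * r - 1) * ((q : ℚ) ^ 2 - 1)) ∧
    (∀ r : ℕ, 1 ≤ r → r ≤ l →
      (orbitWeight (fwsSpace E lam l) (4 * r) : ℚ) =
        (q : ℚ) ^ (4 * r - 2) * ((q : ℚ) + 1) ^ 2) ∧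
    (orbitWeight (fwsSpace E lam l) (4 * l + 2) : ℚ) =
      ((q : ℚ) ^ n - 1) / ((q : ℚ) - 1) - ((q : ℚ) + 1)
        - ((q : ℚ) + 1) * (q : ℚ) ^ 2 *
          ((((q : ℚ) ^ (4 * l - 3) - q) * ((q : ℚ) - 1)
            + ((q : ℚ) + 1) * ((q : ℚ) ^ (4 * l) - 1)) / ((q : ℚ) ^ 4 - 1)) := by
  have : FiniteDimensional K L := Module.Finite.of_finite
  have hl2 : 2 * l < Module.finrank E (IntermediateField.adjoin E {lam}) := by
    rw [ht]
    have : ((2 * l : ℕ) : ℚ) < t := by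
      push_cast
      linarith
    exact_mod_cast this
  have hcE : Nat.card E = q ^ 2 := by rw [Module.natCard_eq_pow_finrank (K := K), hq, hE]
  have hcE' : Nat.card E = Nat.card K ^ 2 := by rw [hcE, hq]
  have hcL : Nat.card L = q ^ n := by rw [Module.natCard_eq_pow_finrank (K := K), hq, hn]
  have hq1 : (1 : ℚ) < q := by exact_mod_cast hq ▸ Finite.one_lt_card (α := K)
  have hq0 : (q : ℚ) - 1 ≠ 0 := by linarith
  have hq4 : (q : ℚ) ^ 4 - 1 ≠ 0 := (sub_pos.2 (one_lt_pow₀ hq1 (by norm_num))).ne'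
  have hw (w : ℕ) := ncard_subspaceDist_eq hl2 hq hcE w
  have h0 := ncard_subspaceDist_zero hl2 hq hcE
  have h4 (r : ℕ) (hr : r + 1 ≤ l) := ncard_subspaceDist_four_mul_succ hl2 hq hcE hr
  have hlt4 (r : ℕ) (hr : r + 1 ≤ l) := ncard_subspaceDist_lt hl2 hq hcE hr
  have hadd (r : ℕ) := ncard_subspaceDist_add hl2 hcE' r
  have htop := ncard_units_subspaceDist_lt hl2 hcE'
  have horb := natCard_sub_one_eq_mul_ncard_cyclicOrbit hl2 hq hcE
  rw [hcL] at horb htop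
  have horb' : ((q : ℚ) ^ n - 1) / (q - 1) = (cyclicOrbit (fwsSpace E lam l)).ncard := by
    rw [div_eq_iff hq0, mul_comm]
    exact_mod_cast horb
  refine ⟨disjoint_powerSpan hl2, finrank_fwsSpace hl2 hcE', horb'.symm, ?_, ?_, ?_, ?_⟩
  · have h := hadd 0
    -- At r = 0 the count reads q² - 1 = 0 + (q - 1) + (q - 1)ω₂.
    rw [hlt4 0 hl, hw (4 * 0 + 2), mul_zero, h0] at h
    simp only [not_lt_zero, Set.ofPred_false, Set.ncard_empty, zero_add] at h
    have h' : (orbitWeight (fwsSpace E lam l) 2 : ℚ) = q := by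
      refine mul_left_cancel₀ hq0 ?_
      have := congrArg (Int.cast : ℤ → ℚ) h
      push_cast at this
      linear_combination -this
    exact_mod_cast h'
  · intro r hr hrl
    obtain ⟨s, rfl⟩ := Nat.exists_eq_add_of_le' hr
    have h := hadd (s + 1)
    rw [hlt4 (s + 1) (by omega), hlt4 s (by omega), h4 s (by omega), hw] at h
    refine mul_left_cancel₀ hq0 ?_
    have := congrArg (Int.cast : ℤ → ℚ) h
    push_cast at this
    rw [show 4 * (s + 1) - 1 = 4 * s + 3 by omega]
    linear_combination -this
  · intro r hr hrl
    obtain ⟨s, rfl⟩ := Nat.exists_eq_add_of_le' hr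
    have h := h4 s (by omega)
    rw [hw] at h
    refine mul_left_cancel₀ hq0 ?_
    have := congrArg (Int.cast : ℤ → ℚ) h
    push_cast at this
    rw [show 4 * (s + 1) - 2 = 4 * s + 2 by omega]
    linear_combination this
  · obtain ⟨s, rfl⟩ := Nat.exists_eq_add_of_le' hl
    have h := hadd (s + 1)
    rw [htop, hlt4 s (by omega), h4 s (by omega), hw] at h
    have := congrArg (Int.cast : ℤ → ℚ) h
    push_cast at this
    rw [show 4 * (s + 1) - 3 = 4 * s + 1 by omega]
    -- The cumulative count below 4l is already closed, so no geometric series is summed; q⁴ - 1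
    -- only clears the denominator in the stated form.
    refine mul_left_cancel₀ hq0 ?_
    field_simp
    linear_combination -((q : ℚ) ^ 4 - 1) * this
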